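/- For real $\alpha>0$, $\beta>0$ and $x\in\mathbb{C}$ with $|x|=1$, let $A_m(\alpha,\beta,x)$, $m\ge 0$, be the Maclaurin coefficients given by $$\frac{(1+xz)^\alpha}{(1-z)^\beta}=\sum_{m=0}^\infty A_m(\alpha,\beta,x)\,z^m,\qquad |z|<1,$$ with principal branches of the powers, and write $A_m(\alpha,x)=A_m(\alpha,1,x)$. Then for every $x\in\mathbb{C}$ with $|x|=1$, every $\alpha\in(0,1)$ and every integer $n\ge 1$, the number $A_{2n-1}(\alpha,1)$ is real and $$A_{2n-1}(\alpha,1)\ \ge\ |A_{2n-1}(\alpha,x)|.$$ -/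

import Mathlib

/-- The function `z ↦ (1 + x z)^α / (1 - z)^β`, with principal powers. For `‖x‖ = 1` and `‖z‖ < 1`
both bases lie in the right half-plane, so it is holomorphic on the open unit disc. -/
noncomputable def brannanFun (α β : ℝ) (x z : ℂ) : ℂ :=
  (1 + x * z) ^ (α : ℂ) / (1 - z) ^ (β : ℂ)

/-- The Maclaurin coefficient `A_n(α, β, x)`, that is, the coefficient of `z^n` in the expansion of
`(1 + x z)^α / (1 - z)^β` at `z = 0`. -/
noncomputable def brannanCoeff (n : ℕ) (α β : ℝ) (x : ℂ) : ℂ :=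
  iteratedDeriv n (brannanFun α β x) 0 / (n.factorial : ℂ)

/-!
For `α ∈ (0, 1)` the coefficients of `(1 + z) ^ α` from the second on are, up to alternating signs,
the moments of a nonnegative weight `w` on `[0, 1]`. Hence the tail of the binomial series is an
integral, and for `|y| < 1`
`A_{p+1}(α, y) = (1 + y) ^ α + (-y) ^ (p + 2) * ∫ w(t) t ^ p / (1 + t y) dt`.

When `p` is even, letting `y → 1` shows that `A_{p+1}(α, 1)` is at least
`2 ^ α + ∫ w(t) t ^ p / (1 + t) dt`. For any other `y`, write `c = |1 + y| / 2` and
`q = (1 - t) / (1 + t)`. From `(1 + t y) + (t + y) = (1 + t) (1 + y)` and `|t + y| ≤ |1 + t y|` one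
gets `|1 + t y| ≥ (1 + t) max(c, q)`. Since `w(t) ≤ α (1 - t) ^ α ≤ 2 ^ α α q ^ α`, the substitution
`t ↦ q` bounds what the integral gains over its value at `y = 1` by
`2 ^ α α ∫ q ^ α (1 / max(c, q) - 1) dq = 2 ^ α (1 - c ^ α) / (α + 1)`,
which is at most the loss `2 ^ α - |1 + y| ^ α = 2 ^ α (1 - c ^ α)` in the first term.
-/

open Set MeasureTheory

theorem iteratedDeriv_mul_div_factorial {𝕜 : Type*} [NontriviallyNormedField 𝕜] [CharZero 𝕜]
    {f g : 𝕜 → 𝕜} {x : 𝕜} {n : ℕ} (hf : ContDiffAt 𝕜 n f x) (hg : ContDiffAt 𝕜 n g x) :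
    iteratedDeriv n (f * g) x / n.factorial =
      ∑ k ∈ Finset.range (n + 1),
        iteratedDeriv k f x / k.factorial * (iteratedDeriv (n - k) g x / (n - k).factorial) := by
  rw [iteratedDeriv_mul hf hg, Finset.sum_div]
  refine Finset.sum_congr rfl fun k hk ↦ ?_
  rw [Nat.cast_choose 𝕜 (Finset.mem_range_succ_iff.1 hk)]
  have := n.factorial_ne_zero
  field_simp

theorem iteratedDeriv_div_factorial_eq_coeff {𝕜 : Type*} [NontriviallyNormedField 𝕜]
    [CompleteSpace 𝕜] [CharZero 𝕜] {f : 𝕜 → 𝕜} {x : 𝕜} {p : FormalMultilinearSeries 𝕜 𝕜 𝕜}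
    (h : HasFPowerSeriesAt f p x) (n : ℕ) : iteratedDeriv n f x / n.factorial = p.coeff n := by
  obtain ⟨r, hr⟩ := h
  rw [div_eq_iff (Nat.cast_ne_zero.2 n.factorial_ne_zero), iteratedDeriv_eq_iteratedFDeriv]
  have := hr.factorial_smul 1 n
  rw [← this, nsmul_eq_mul, mul_comm]
  rfl

theorem iteratedDeriv_one_add_mul_cpow_div_factorial (a x : ℂ) (k : ℕ) :
    iteratedDeriv k (fun z ↦ (1 + x * z) ^ a) 0 / k.factorial = Ring.choose a k * x ^ k := by
  have h : HasFPowerSeriesAt (fun z ↦ (1 + z) ^ a) (binomialSeries ℂ a)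
      ((x • ContinuousLinearMap.id ℂ ℂ) 0) := by
    simpa using Complex.one_add_cpow_hasFPowerSeriesAt_zero
  refine (iteratedDeriv_div_factorial_eq_coeff h.compContinuousLinearMap k).trans ?_
  rw [FormalMultilinearSeries.coeff, FormalMultilinearSeries.compContinuousLinearMap_apply,
    binomialSeries_apply]
  simp [Function.comp_def, List.prod_replicate]

theorem iteratedDeriv_inv_one_sub_cpow_div_factorial (b : ℂ) (k : ℕ) :
    iteratedDeriv k (fun z ↦ ((1 - z) ^ b)⁻¹) 0 / k.factorial = Ring.multichoose b k := by
  have h := (Complex.one_div_one_sub_cpow_hasFPowerSeriesOnBall_zero b).hasFPowerSeriesAt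
  simp only [one_div] at h
  rw [iteratedDeriv_div_factorial_eq_coeff h, FormalMultilinearSeries.coeff_ofScalars,
    Ring.multichoose_eq]

theorem brannanCoeff_eq_sum (m : ℕ) (α β : ℝ) (x : ℂ) :
    brannanCoeff m α β x = ∑ k ∈ Finset.range (m + 1),
      Ring.choose (α : ℂ) k * x ^ k * Ring.multichoose (β : ℂ) (m - k) := by
  have hf : ContDiffAt ℂ m (fun z ↦ (1 + x * z) ^ (α : ℂ)) 0 :=
    (AnalyticAt.cpow (by fun_prop) analyticAt_const (by simp)).contDiffAt
  have hg : ContDiffAt ℂ m (fun z : ℂ ↦ ((1 - z) ^ (β : ℂ))⁻¹) 0 :=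
    (AnalyticAt.inv (AnalyticAt.cpow (by fun_prop) analyticAt_const (by simp)) (by simp)).contDiffAt
  have hfg : brannanFun α β x =
      (fun z ↦ (1 + x * z) ^ (α : ℂ)) * fun z ↦ ((1 - z) ^ (β : ℂ))⁻¹ :=
    funext fun _ ↦ div_eq_mul_inv _ _
  simp only [brannanCoeff, hfg, iteratedDeriv_mul_div_factorial hf hg,
    iteratedDeriv_one_add_mul_cpow_div_factorial, iteratedDeriv_inv_one_sub_cpow_div_factorial]

theorem brannanCoeff_one_right (m : ℕ) (α : ℝ) (x : ℂ) :
    brannanCoeff m α 1 x = ∑ k ∈ Finset.range (m + 1), Ring.choose (α : ℂ) k * x ^ k := by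
  simp [brannanCoeff_eq_sum, Ring.multichoose_one]

theorem hasSum_choose_mul_pow (a : ℂ) {y : ℂ} (hy : ‖y‖ < 1) :
    HasSum (fun k ↦ Ring.choose a k * y ^ k) ((1 + y) ^ a) := by
  have h := (Complex.one_add_cpow_hasFPowerSeriesOnBall_zero (a := a)).hasSum (y := y)
    (by simpa [← ofReal_norm] using hy)
  simp only [binomialSeries_apply, List.ofFn_const, List.prod_replicate, zero_add, smul_eq_mul] at h
  exact h

theorem continuous_brannanCoeff_one_right (m : ℕ) (α : ℝ) : Continuous (brannanCoeff m α 1) := by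
  simp only [funext (brannanCoeff_one_right m α)]
  fun_prop

theorem brannanCoeff_one_right_ofReal (m : ℕ) (α r : ℝ) :
    brannanCoeff m α 1 r = ((∑ k ∈ Finset.range (m + 1), Ring.choose α k * r ^ k : ℝ) : ℂ) := by
  simp [brannanCoeff_one_right, Complex.ofReal_choose]

theorem succ_mul_ringChoose_succ {R : Type*} [CommRing R] [BinomialRing R] (a : R) (k : ℕ) :
    (k + 1) * Ring.choose a (k + 1) = (a - k) * Ring.choose a k := by
  simpa [mul_comm] using Ring.choose_smul_choose a k.le_succ

theorem mul_Gamma_natCast_add_one_sub {α : ℝ} (hα : α < 1) (k : ℕ) :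
    α * Real.Gamma (k + 1 - α) =
      (-1) ^ k * (k + 1).factorial * Ring.choose α (k + 1) * Real.Gamma (1 - α) := by
  induction k with
  | zero => simp
  | succ k ih =>
    have hk : (k + 1 - α : ℝ) ≠ 0 := by linarith [k.cast_nonneg (α := ℝ)]
    have hchoose := succ_mul_ringChoose_succ α (k + 1)
    have hΓ := Real.Gamma_add_one hk
    rw [Nat.factorial_succ (k + 1)]
    push_cast at hchoose ⊢
    rw [show (k : ℝ) + 1 + 1 - α = k + 1 - α + 1 by ring, hΓ]
    linear_combination (k + 1 - α) * ih +
      (-1) ^ k * (k + 1).factorial * Real.Gamma (1 - α) * hchoose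

theorem integral_rpow_mul_one_sub_rpow {a b : ℝ} (ha : 0 < a) (hb : 0 < b) :
    ∫ t in (0 : ℝ)..1, t ^ (a - 1) * (1 - t) ^ (b - 1) = ProbabilityTheory.beta a b := by
  have h : Complex.betaIntegral a b =
      ((∫ t in (0 : ℝ)..1, t ^ (a - 1) * (1 - t) ^ (b - 1) : ℝ) : ℂ) := by
    rw [Complex.betaIntegral, ← intervalIntegral.integral_ofReal]
    refine intervalIntegral.integral_congr fun t ht ↦ ?_
    rw [uIcc_of_le zero_le_one] at ht
    simp [Complex.ofReal_cpow ht.1, Complex.ofReal_cpow (sub_nonneg.2 ht.2)]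
  rw [ProbabilityTheory.beta_eq_betaIntegralReal a b ha hb, h, Complex.ofReal_re]

/-- The weight on `[0, 1]` whose moments are, up to sign, the coefficients of `(1 + z) ^ α` from
the second on: see `integral_brannanWeight_mul_pow`. -/
noncomputable def brannanWeight (α t : ℝ) : ℝ :=
  Real.sin (Real.pi * α) / Real.pi * (t ^ (1 - α) * (1 - t) ^ α)

theorem continuous_brannanWeight {α : ℝ} (hα : α ∈ Icc (0 : ℝ) 1) :
    Continuous (brannanWeight α) := by
  have h₁ : Continuous fun t : ℝ ↦ t ^ (1 - α) :=
    continuous_id.rpow_const fun _ ↦ Or.inr (sub_nonneg.2 hα.2)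
  have h₂ : Continuous fun t : ℝ ↦ (1 - t) ^ α :=
    (continuous_const.sub continuous_id).rpow_const fun _ ↦ Or.inr hα.1
  exact continuous_const.mul (h₁.mul h₂)

theorem brannanWeight_nonneg {α t : ℝ} (hα : α ∈ Icc (0 : ℝ) 1) (ht : t ∈ Icc (0 : ℝ) 1) :
    0 ≤ brannanWeight α t := by
  have hsin : 0 ≤ Real.sin (Real.pi * α) := Real.sin_nonneg_of_nonneg_of_le_pi
    (mul_nonneg Real.pi_nonneg hα.1) (mul_le_of_le_one_right Real.pi_nonneg hα.2)
  exact mul_nonneg (div_nonneg hsin Real.pi_nonneg)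
    (mul_nonneg (Real.rpow_nonneg ht.1 _) (Real.rpow_nonneg (sub_nonneg.2 ht.2) _))

theorem brannanWeight_le {α t : ℝ} (hα : α ∈ Icc (0 : ℝ) 1) (ht : t ∈ Icc (0 : ℝ) 1) :
    brannanWeight α t ≤ α * (1 - t) ^ α := by
  have hsin : Real.sin (Real.pi * α) / Real.pi ≤ α := by
    rw [div_le_iff₀' Real.pi_pos]
    exact Real.sin_le (mul_nonneg Real.pi_nonneg hα.1)
  have hs : 0 ≤ (1 - t) ^ α := Real.rpow_nonneg (sub_nonneg.2 ht.2) _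
  refine mul_le_mul hsin (mul_le_of_le_one_left hs ?_)
    (mul_nonneg (Real.rpow_nonneg ht.1 _) hs) hα.1
  exact Real.rpow_le_one ht.1 ht.2 (sub_nonneg.2 hα.2)

theorem integral_brannanWeight_mul_pow {α : ℝ} (hα : α ∈ Ioo (0 : ℝ) 1) (k : ℕ) :
    ∫ t in (0 : ℝ)..1, brannanWeight α t * t ^ k = (-1) ^ (k + 1) * Ring.choose α (k + 2) := by
  have hk : (0 : ℝ) ≤ k := k.cast_nonneg
  have hbeta : ∫ t in (0 : ℝ)..1, brannanWeight α t * t ^ k =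
      Real.sin (Real.pi * α) / Real.pi * ProbabilityTheory.beta (k + 2 - α) (α + 1) := by
    rw [← integral_rpow_mul_one_sub_rpow (by linarith [hα.2]) (by linarith [hα.1]),
      ← intervalIntegral.integral_const_mul]
    refine intervalIntegral.integral_congr fun t ht ↦ ?_
    rw [uIcc_of_le zero_le_one] at ht
    simp only [brannanWeight, add_sub_cancel_right]
    rw [show (k : ℝ) + 2 - α - 1 = k + (1 - α) by ring,
      Real.rpow_add_of_nonneg ht.1 hk (sub_nonneg.2 hα.2.le), Real.rpow_natCast]
    ring
  have hreflect := Real.Gamma_mul_Gamma_one_sub α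
  have hΓ := mul_Gamma_natCast_add_one_sub hα.2 (k + 1)
  have hsin : Real.sin (Real.pi * α) ≠ 0 := (Real.sin_pos_of_pos_of_lt_pi
    (mul_pos Real.pi_pos hα.1) (mul_lt_of_lt_one_right Real.pi_pos hα.2)).ne'
  rw [eq_div_iff hsin] at hreflect
  push_cast at hΓ
  rw [hbeta, ProbabilityTheory.beta, Real.Gamma_add_one hα.1.ne',
    show (k : ℝ) + 2 - α + (α + 1) = (k + 2 : ℕ) + 1 by push_cast; ring,
    Real.Gamma_nat_eq_factorial]
  have hfac : ((k + 2).factorial : ℝ) ≠ 0 := by positivity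
  have hpi := Real.pi_ne_zero
  rw [show (k : ℝ) + 1 + 1 - α = k + 2 - α by ring, show k + 1 + 1 = k + 2 from rfl] at hΓ
  field_simp
  linear_combination Real.sin (Real.pi * α) * Real.Gamma α * hΓ +
    (-1) ^ (k + 1) * (k + 2).factorial * Ring.choose α (k + 2) * hreflect

theorem hasSum_integral_mul_pow {f : ℝ → ℝ} (hf : IntervalIntegrable f volume 0 1) {w : ℂ}
    (hw : ‖w‖ < 1) :
    HasSum (fun k ↦ ((∫ t in (0 : ℝ)..1, f t * t ^ k : ℝ) : ℂ) * w ^ k)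
      (∫ t in (0 : ℝ)..1, (f t : ℂ) * (1 - t * w)⁻¹) := by
  have hterm (k : ℕ) : ((∫ t in (0 : ℝ)..1, f t * t ^ k : ℝ) : ℂ) * w ^ k =
      ∫ t in (0 : ℝ)..1, (f t : ℂ) * (t * w) ^ k := by
    rw [← intervalIntegral.integral_ofReal, ← intervalIntegral.integral_mul_const]
    simp only [Complex.ofReal_mul, Complex.ofReal_pow, mul_pow, mul_assoc]
  have hnorm {t : ℝ} (ht : t ∈ uIoc (0 : ℝ) 1) : ‖(t * w : ℂ)‖ ≤ ‖w‖ := by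
    rw [uIoc_of_le zero_le_one] at ht
    rw [norm_mul, Complex.norm_real, Real.norm_of_nonneg ht.1.le]
    exact mul_le_of_le_one_left (norm_nonneg w) ht.2
  have hmeas : AEStronglyMeasurable (fun t ↦ (f t : ℂ)) (volume.restrict (uIoc 0 1)) :=
    Complex.continuous_ofReal.comp_aestronglyMeasurable hf.aestronglyMeasurable_restrict_uIoc
  simp only [hterm]
  refine intervalIntegral.hasSum_integral_of_dominated_convergence (fun k t ↦ |f t| * ‖w‖ ^ k)
    (fun k ↦ hmeas.mul (by fun_prop)) (fun k ↦ ae_of_all _ fun t ht ↦ ?_)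
    (ae_of_all _ fun t _ ↦ (summable_geometric_of_lt_one (norm_nonneg w) hw).mul_left _) ?_
    (ae_of_all _ fun t ht ↦
      (hasSum_geometric_of_norm_lt_one ((hnorm ht).trans_lt hw)).mul_left _)
  · rw [norm_mul, norm_pow, Complex.norm_real, Real.norm_eq_abs]
    gcongr
    exact hnorm ht
  · simp only [tsum_mul_left]
    exact hf.abs.mul_const _

theorem brannanCoeff_eq_cpow_add_integral {α : ℝ} (hα : α ∈ Ioo (0 : ℝ) 1) (p : ℕ) {y : ℂ}
    (hy : ‖y‖ < 1) :
    brannanCoeff (p + 1) α 1 y = (1 + y) ^ (α : ℂ) + (-y) ^ (p + 2) *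
      ∫ t in (0 : ℝ)..1, ((brannanWeight α t * t ^ p : ℝ) : ℂ) * (1 + t * y)⁻¹ := by
  have hw := continuous_brannanWeight (Ioo_subset_Icc_self hα)
  have hseries := (hasSum_nat_add_iff' (p + 2)).2 (hasSum_choose_mul_pow α hy)
  have hintegral := (hasSum_integral_mul_pow (f := fun t ↦ brannanWeight α t * t ^ p)
    (Continuous.intervalIntegrable (by fun_prop) 0 1) (w := -y)
    (by rwa [norm_neg])).mul_left (-(-y) ^ (p + 2))
  have hterm (k : ℕ) : -(-y) ^ (p + 2) *
      (((∫ t in (0 : ℝ)..1, brannanWeight α t * t ^ p * t ^ k : ℝ) : ℂ) * (-y) ^ k) =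
      Ring.choose (α : ℂ) (k + (p + 2)) * y ^ (k + (p + 2)) := by
    simp only [mul_assoc, ← pow_add, integral_brannanWeight_mul_pow hα]
    rw [show p + k + 2 = k + (p + 2) by ring, neg_pow y (p + 2), neg_pow y k]
    push_cast [Complex.ofReal_choose]
    ring_nf
    simp [pow_mul']
  simp only [hterm] at hintegral
  have htail := hseries.unique hintegral
  simp only [mul_neg, sub_neg_eq_add] at htail
  rw [brannanCoeff_one_right]
  linear_combination -htail

theorem norm_ofReal_add_le_norm_one_add_mul {y : ℂ} (hy : ‖y‖ ≤ 1) {t : ℝ}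
    (ht : |t| ≤ 1) : ‖t + y‖ ≤ ‖1 + t * y‖ := by
  have hdiff : ‖1 + t * y‖ ^ 2 - ‖t + y‖ ^ 2 = (1 - t ^ 2) * (1 - ‖y‖ ^ 2) := by
    simp only [Complex.sq_norm, Complex.normSq_apply, Complex.add_re, Complex.add_im,
      Complex.one_re, Complex.one_im, Complex.re_ofReal_mul, Complex.im_ofReal_mul,
      Complex.ofReal_re, Complex.ofReal_im]
    ring
  have hnonneg : 0 ≤ (1 - t ^ 2) * (1 - ‖y‖ ^ 2) :=
    mul_nonneg (sub_nonneg.2 ((sq_le_one_iff_abs_le_one t).2 ht))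
      (sub_nonneg.2 (pow_le_one₀ (norm_nonneg y) hy))
  exact (sq_le_sq₀ (norm_nonneg _) (norm_nonneg _)).1 (by linarith)

theorem mul_max_le_norm_one_add_mul {y : ℂ} (hy : ‖y‖ ≤ 1) {t : ℝ} (ht : t ∈ Icc (0 : ℝ) 1) :
    (1 + t) * max (‖1 + y‖ / 2) ((1 - t) / (1 + t)) ≤ ‖1 + t * y‖ := by
  have ht' : 0 < 1 + t := by linarith [ht.1]
  rw [mul_max_of_nonneg _ _ ht'.le, mul_div_cancel₀ _ ht'.ne', max_le_iff]
  constructor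
  · have hsplit : (1 + t) * ‖1 + y‖ ≤ ‖1 + t * y‖ + ‖t + y‖ :=
      calc (1 + t) * ‖1 + y‖ = ‖((1 + t : ℝ) : ℂ) * (1 + y)‖ := by
            rw [norm_mul, Complex.norm_real, Real.norm_of_nonneg ht'.le]
        _ = ‖(1 + t * y) + (t + y)‖ := by push_cast; ring_nf
        _ ≤ ‖1 + t * y‖ + ‖t + y‖ := norm_add_le _ _
    linarith [norm_ofReal_add_le_norm_one_add_mul hy ((abs_of_nonneg ht.1).trans_le ht.2)]
  · have hty : ‖t * y‖ ≤ t := by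
      rw [norm_mul, Complex.norm_real, Real.norm_of_nonneg ht.1]
      exact mul_le_of_le_one_right ht.1 hy
    have := norm_sub_le_norm_add 1 (t * y)
    rw [norm_one] at this
    linarith

theorem continuous_rpow_mul_inv_max_sub_one {α c : ℝ} (hα : 0 ≤ α) (hc : 0 < c) :
    Continuous fun q : ℝ ↦ q ^ α * ((max c q)⁻¹ - 1) :=
  (continuous_id.rpow_const fun _ ↦ Or.inr hα).mul
    (((continuous_const.max continuous_id).inv₀ fun q ↦ (hc.trans_le (le_max_left c q)).ne').sub
      continuous_const)

theorem integral_rpow_mul_inv_max_sub_one {α c : ℝ} (hα : 0 < α) (hc : c ∈ Ioc (0 : ℝ) 1) :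
    ∫ q in (0 : ℝ)..1, q ^ α * ((max c q)⁻¹ - 1) = (1 - c ^ α) / (α * (α + 1)) := by
  have hcont := continuous_rpow_mul_inv_max_sub_one hα.le hc.1
  have hleft : ∫ q in (0 : ℝ)..c, q ^ α * ((max c q)⁻¹ - 1) =
      c ^ (α + 1) / (α + 1) * (c⁻¹ - 1) := by
    rw [intervalIntegral.integral_congr (g := fun q ↦ q ^ α * (c⁻¹ - 1)) fun q hq ↦ by
      rw [uIcc_of_le hc.1.le] at hq
      simp only [max_eq_left hq.2]]
    rw [intervalIntegral.integral_mul_const, integral_rpow (Or.inl (by linarith)),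
      Real.zero_rpow (by linarith), sub_zero]
  have hright : ∫ q in c..1, q ^ α * ((max c q)⁻¹ - 1) =
      (1 - c ^ α) / α - (1 - c ^ (α + 1)) / (α + 1) := by
    rw [intervalIntegral.integral_congr (g := fun q ↦ q ^ (α - 1) - q ^ α) fun q hq ↦ by
      rw [uIcc_of_le hc.2] at hq
      simp only [max_eq_right hq.1, Real.rpow_sub_one (hc.1.trans_le hq.1).ne', mul_sub, mul_one,
        div_eq_mul_inv]]
    have h0 : (0 : ℝ) ∉ uIcc c 1 := by simp [uIcc_of_le hc.2, hc.1]
    rw [intervalIntegral.integral_sub (intervalIntegral.intervalIntegrable_rpow (Or.inr h0))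
        (intervalIntegral.intervalIntegrable_rpow (Or.inr h0)),
      integral_rpow (Or.inl (by linarith)), integral_rpow (Or.inl (by linarith))]
    simp only [sub_add_cancel, Real.one_rpow]
  rw [← intervalIntegral.integral_add_adjacent_intervals (hcont.intervalIntegrable 0 c)
    (hcont.intervalIntegrable c 1), hleft, hright, Real.rpow_add_one hc.1.ne']
  have := hc.1.ne'
  field_simp
  ring

theorem continuousOn_one_sub_div_one_add :
    ContinuousOn (fun t : ℝ ↦ (1 - t) / (1 + t)) (Icc 0 1) :=
  ContinuousOn.div (by fun_prop) (by fun_prop) fun _ ht ↦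
    (add_pos_of_pos_of_nonneg one_pos ht.1).ne'

theorem integral_comp_one_sub_div_one_add {g : ℝ → ℝ} (hg : Continuous g) :
    ∫ t in (0 : ℝ)..1, g ((1 - t) / (1 + t)) * (2 / (1 + t) ^ 2) = ∫ q in (0 : ℝ)..1, g q := by
  have hpos {t : ℝ} (ht : t ∈ uIcc (0 : ℝ) 1) : 1 + t ≠ 0 := by
    rw [uIcc_of_le zero_le_one] at ht
    linarith [ht.1]
  have hderiv (t : ℝ) (ht : t ∈ uIcc (0 : ℝ) 1) :
      HasDerivAt (fun t ↦ (1 - t) / (1 + t)) (-(2 / (1 + t) ^ 2)) t := by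
    refine (((hasDerivAt_id t).const_sub 1).div ((hasDerivAt_id t).const_add 1)
      (hpos ht)).congr_deriv ?_
    simp only [id]
    ring
  have hcont : ContinuousOn (fun t : ℝ ↦ -(2 / (1 + t) ^ 2)) (uIcc 0 1) :=
    (ContinuousOn.div (by fun_prop) (by fun_prop) fun t ht ↦ pow_ne_zero 2 (hpos ht)).neg
  have h := intervalIntegral.integral_comp_mul_deriv hderiv hcont hg
  simp only [Function.comp_apply, mul_neg, intervalIntegral.integral_neg] at h
  rw [sub_self, zero_div, sub_zero, add_zero, div_one, intervalIntegral.integral_symm 0 1] at h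
  exact neg_injective h

theorem brannanWeight_mul_pow_le {α t : ℝ} (hα : α ∈ Icc (0 : ℝ) 1) (ht : t ∈ Icc (0 : ℝ) 1)
    (p : ℕ) : brannanWeight α t * t ^ p ≤ 2 ^ α * α * ((1 - t) / (1 + t)) ^ α := by
  have hα₀ := hα.1
  have hs : 0 < 1 + t := add_pos_of_pos_of_nonneg one_pos ht.1
  have hq : 0 ≤ (1 - t) / (1 + t) := div_nonneg (sub_nonneg.2 ht.2) hs.le
  calc brannanWeight α t * t ^ p ≤ brannanWeight α t :=
        mul_le_of_le_one_right (brannanWeight_nonneg hα ht) (pow_le_one₀ ht.1 ht.2)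
    _ ≤ α * (1 - t) ^ α := brannanWeight_le hα ht
    _ = (1 + t) ^ α * α * ((1 - t) / (1 + t)) ^ α := by
        rw [Real.div_rpow (sub_nonneg.2 ht.2) hs.le]
        field_simp
    _ ≤ 2 ^ α * α * ((1 - t) / (1 + t)) ^ α := by
        gcongr
        linarith [ht.2]

theorem brannanWeight_mul_inv_max_sub_inv_le {α c t : ℝ} (hα : α ∈ Icc (0 : ℝ) 1)
    (hc : c ∈ Ioc (0 : ℝ) 1) (ht : t ∈ Icc (0 : ℝ) 1) (p : ℕ) :
    brannanWeight α t * t ^ p * (((1 + t) * max c ((1 - t) / (1 + t)))⁻¹ - (1 + t)⁻¹) ≤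
      2 ^ α * α * (((1 - t) / (1 + t)) ^ α * ((max c ((1 - t) / (1 + t)))⁻¹ - 1) *
        (2 / (1 + t) ^ 2)) := by
  have hα₀ := hα.1
  have hs : 0 < 1 + t := add_pos_of_pos_of_nonneg one_pos ht.1
  set q := (1 - t) / (1 + t)
  have hq₀ : 0 ≤ q := div_nonneg (sub_nonneg.2 ht.2) hs.le
  have hq₁ : q ≤ 1 := (div_le_one hs).2 (by linarith [ht.1])
  have hmax : 0 ≤ (max c q)⁻¹ - 1 :=
    sub_nonneg.2 ((one_le_inv₀ (hc.1.trans_le (le_max_left c q))).2 (max_le hc.2 hq₁))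
  have hinv : (1 + t)⁻¹ ≤ 2 / (1 + t) ^ 2 := by
    rw [inv_eq_one_div, div_le_div_iff₀ hs (pow_pos hs 2)]
    nlinarith [ht.2]
  calc brannanWeight α t * t ^ p * (((1 + t) * max c q)⁻¹ - (1 + t)⁻¹)
      = brannanWeight α t * t ^ p * (((max c q)⁻¹ - 1) * (1 + t)⁻¹) := by
        rw [mul_inv]
        ring
    _ ≤ 2 ^ α * α * q ^ α * (((max c q)⁻¹ - 1) * (2 / (1 + t) ^ 2)) :=
        mul_le_mul (brannanWeight_mul_pow_le hα ht p) (mul_le_mul_of_nonneg_left hinv hmax)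
          (mul_nonneg hmax (inv_nonneg.2 hs.le))
          (by positivity)
    _ = 2 ^ α * α * (q ^ α * ((max c q)⁻¹ - 1) * (2 / (1 + t) ^ 2)) := by ring

theorem intervalIntegrable_brannanWeight_mul_inv {α : ℝ} (hα : α ∈ Icc (0 : ℝ) 1) (p : ℕ)
    {g : ℝ → ℝ} (hg : ContinuousOn g (Icc 0 1)) (hg₀ : ∀ t ∈ Icc (0 : ℝ) 1, g t ≠ 0) :
    IntervalIntegrable (fun t ↦ brannanWeight α t * t ^ p * (g t)⁻¹) volume 0 1 := by
  have hw := continuous_brannanWeight hα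
  refine ContinuousOn.intervalIntegrable_of_Icc zero_le_one ?_
  exact ContinuousOn.mul (by fun_prop) (hg.inv₀ hg₀)

theorem intervalIntegrable_brannanWeight_mul_inv_one_add_mul {α r : ℝ} (hα : α ∈ Icc (0 : ℝ) 1)
    (hr : 0 ≤ r) (p : ℕ) :
    IntervalIntegrable (fun t ↦ brannanWeight α t * t ^ p * (1 + t * r)⁻¹) volume 0 1 :=
  intervalIntegrable_brannanWeight_mul_inv hα p (by fun_prop) fun _ ht ↦
    (add_pos_of_pos_of_nonneg one_pos (mul_nonneg ht.1 hr)).ne'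

theorem intervalIntegrable_brannanWeight_mul_inv_max {α c : ℝ} (hα : α ∈ Icc (0 : ℝ) 1)
    (hc : 0 < c) (p : ℕ) :
    IntervalIntegrable
      (fun t ↦ brannanWeight α t * t ^ p * ((1 + t) * max c ((1 - t) / (1 + t)))⁻¹)
      volume 0 1 :=
  intervalIntegrable_brannanWeight_mul_inv hα p
    (ContinuousOn.mul (by fun_prop) (continuous_const.max continuous_id |>.comp_continuousOn
      continuousOn_one_sub_div_one_add))
    fun _ ht ↦ mul_ne_zero (add_pos_of_pos_of_nonneg one_pos ht.1).ne'
      (hc.trans_le (le_max_left c _)).ne'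

theorem rpow_add_integral_brannanWeight_inv_max_le {α c : ℝ} (hα : α ∈ Ioc (0 : ℝ) 1)
    (hc : c ∈ Ioc (0 : ℝ) 1) (p : ℕ) :
    (2 * c) ^ α + ∫ t in (0 : ℝ)..1,
        brannanWeight α t * t ^ p * ((1 + t) * max c ((1 - t) / (1 + t)))⁻¹ ≤
      2 ^ α + ∫ t in (0 : ℝ)..1, brannanWeight α t * t ^ p * (1 + t)⁻¹ := by
  have hα' := Ioc_subset_Icc_self hα
  have hmax := intervalIntegrable_brannanWeight_mul_inv_max hα' hc.1 p
  have hinv := intervalIntegrable_brannanWeight_mul_inv_one_add_mul hα' zero_le_one p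
  simp only [mul_one] at hinv
  have hcont := continuous_rpow_mul_inv_max_sub_one hα.1.le hc.1
  have hsubst : IntervalIntegrable (fun t ↦ ((1 - t) / (1 + t)) ^ α *
      ((max c ((1 - t) / (1 + t)))⁻¹ - 1) * (2 / (1 + t) ^ 2)) volume 0 1 :=
    ((hcont.comp_continuousOn continuousOn_one_sub_div_one_add).mul (ContinuousOn.div
      (by fun_prop) (by fun_prop) fun t ht ↦ pow_ne_zero 2
        (add_pos_of_pos_of_nonneg one_pos ht.1).ne')).intervalIntegrable_of_Icc zero_le_one
  have hbound : ∫ t in (0 : ℝ)..1, brannanWeight α t * t ^ p *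
        (((1 + t) * max c ((1 - t) / (1 + t)))⁻¹ - (1 + t)⁻¹) ≤ 2 ^ α * (1 - c ^ α) :=
    calc _ ≤ ∫ t in (0 : ℝ)..1, 2 ^ α * α * (((1 - t) / (1 + t)) ^ α *
            ((max c ((1 - t) / (1 + t)))⁻¹ - 1) * (2 / (1 + t) ^ 2)) := by
          refine intervalIntegral.integral_mono_on zero_le_one ?_ (hsubst.const_mul _) fun t ht ↦
            brannanWeight_mul_inv_max_sub_inv_le hα' hc ht p
          simpa only [mul_sub] using hmax.sub hinv
      _ = 2 ^ α * α * ((1 - c ^ α) / (α * (α + 1))) := by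
          rw [intervalIntegral.integral_const_mul, integral_comp_one_sub_div_one_add hcont,
            integral_rpow_mul_inv_max_sub_one hα.1 hc]
      _ = 2 ^ α * ((1 - c ^ α) / (α + 1)) := by
          have := hα.1.ne'
          field_simp
      _ ≤ 2 ^ α * (1 - c ^ α) := by
          gcongr
          exact div_le_self (sub_nonneg.2 (Real.rpow_le_one hc.1.le hc.2 hα.1.le))
            (by linarith [hα.1])
  simp only [mul_sub] at hbound
  rw [intervalIntegral.integral_sub hmax hinv] at hbound
  rw [Real.mul_rpow zero_le_two hc.1.le]
  linarith

theorem norm_integral_brannanWeight_mul_inv_le {α : ℝ} (hα : α ∈ Icc (0 : ℝ) 1) (p : ℕ) {y : ℂ}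
    (hy : ‖y‖ ≤ 1) (hy' : 1 + y ≠ 0) :
    ‖∫ t in (0 : ℝ)..1, ((brannanWeight α t * t ^ p : ℝ) : ℂ) * (1 + t * y)⁻¹‖ ≤
      ∫ t in (0 : ℝ)..1, brannanWeight α t * t ^ p *
        ((1 + t) * max (‖1 + y‖ / 2) ((1 - t) / (1 + t)))⁻¹ := by
  have hc : 0 < ‖1 + y‖ / 2 := half_pos (norm_pos_iff.2 hy')
  refine intervalIntegral.norm_integral_le_of_norm_le zero_le_one (ae_of_all _ fun t ht ↦ ?_)
    (intervalIntegrable_brannanWeight_mul_inv_max hα hc p)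
  have ht' := Ioc_subset_Icc_self ht
  have hw : 0 ≤ brannanWeight α t * t ^ p :=
    mul_nonneg (brannanWeight_nonneg hα ht') (pow_nonneg ht'.1 p)
  rw [norm_mul, norm_inv, Complex.norm_real, Real.norm_of_nonneg hw]
  gcongr
  · exact mul_pos (add_pos one_pos ht.1) (hc.trans_le (le_max_left _ _))
  · exact mul_max_le_norm_one_add_mul hy ht'

theorem norm_brannanCoeff_le_of_norm_lt_one {α : ℝ} (hα : α ∈ Ioo (0 : ℝ) 1) (p : ℕ) {y : ℂ}
    (hy : ‖y‖ < 1) :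
    ‖brannanCoeff (p + 1) α 1 y‖ ≤
      2 ^ α + ∫ t in (0 : ℝ)..1, brannanWeight α t * t ^ p * (1 + t)⁻¹ := by
  have hy' : 1 + y ≠ 0 := fun h ↦ hy.ne <| by
    rw [eq_neg_of_add_eq_zero_right h, norm_neg, norm_one]
  have hintegral := norm_integral_brannanWeight_mul_inv_le (Ioo_subset_Icc_self hα) p hy.le hy'
  set c := ‖1 + y‖ / 2 with hc
  have hc₀ : 0 < c := half_pos (norm_pos_iff.2 hy')
  have hc₁ : c ≤ 1 := by
    have := norm_add_le 1 y
    rw [norm_one] at this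
    linarith
  calc ‖brannanCoeff (p + 1) α 1 y‖
      ≤ ‖(1 + y) ^ (α : ℂ)‖ + ‖(-y) ^ (p + 2)‖ *
          ‖∫ t in (0 : ℝ)..1, ((brannanWeight α t * t ^ p : ℝ) : ℂ) * (1 + t * y)⁻¹‖ := by
        rw [brannanCoeff_eq_cpow_add_integral hα p hy, ← norm_mul]
        exact norm_add_le _ _
    _ ≤ (2 * c) ^ α + ∫ t in (0 : ℝ)..1,
          brannanWeight α t * t ^ p * ((1 + t) * max c ((1 - t) / (1 + t)))⁻¹ := by
        refine add_le_add (le_of_eq ?_) ((mul_le_of_le_one_left (norm_nonneg _) ?_).trans hintegral)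
        · rw [Complex.norm_cpow_real, hc, mul_div_cancel₀ _ two_ne_zero]
        · rw [norm_pow, norm_neg]
          exact pow_le_one₀ (norm_nonneg y) hy.le
    _ ≤ _ := rpow_add_integral_brannanWeight_inv_max_le (Ioo_subset_Ioc_self hα) ⟨hc₀, hc₁⟩ p

theorem norm_brannanCoeff_le {α : ℝ} (hα : α ∈ Ioo (0 : ℝ) 1) (p : ℕ) {x : ℂ} (hx : ‖x‖ ≤ 1) :
    ‖brannanCoeff (p + 1) α 1 x‖ ≤
      2 ^ α + ∫ t in (0 : ℝ)..1, brannanWeight α t * t ^ p * (1 + t)⁻¹ := by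
  refine le_on_closure (s := Metric.ball (0 : ℂ) 1)
    (fun y hy ↦ norm_brannanCoeff_le_of_norm_lt_one hα p (mem_ball_zero_iff.1 hy))
    (continuous_brannanCoeff_one_right (p + 1) α).norm.continuousOn continuousOn_const ?_
  rwa [closure_ball 0 one_ne_zero, mem_closedBall_zero_iff]

theorem le_re_brannanCoeff_ofReal {α : ℝ} (hα : α ∈ Ioo (0 : ℝ) 1) {p : ℕ} (hp : Even p) {r : ℝ}
    (hr : r ∈ Ioo (0 : ℝ) 1) :
    (1 + r) ^ α + r ^ (p + 2) * ∫ t in (0 : ℝ)..1, brannanWeight α t * t ^ p * (1 + t)⁻¹ ≤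
      (brannanCoeff (p + 1) α 1 r).re := by
  have hα' := Ioo_subset_Icc_self hα
  have hrep : brannanCoeff (p + 1) α 1 r = (((1 + r) ^ α + r ^ (p + 2) *
      ∫ t in (0 : ℝ)..1, brannanWeight α t * t ^ p * (1 + t * r)⁻¹ : ℝ) : ℂ) := by
    rw [brannanCoeff_eq_cpow_add_integral hα p
      (by rw [Complex.norm_real, Real.norm_of_nonneg hr.1.le]; exact hr.2)]
    push_cast [Complex.ofReal_cpow (add_pos one_pos hr.1).le, ← intervalIntegral.integral_ofReal]
    rw [(hp.add even_two).neg_pow]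
  rw [hrep, Complex.ofReal_re]
  gcongr
  · exact pow_nonneg hr.1.le _
  have hinv := intervalIntegrable_brannanWeight_mul_inv_one_add_mul hα' zero_le_one p
  simp only [mul_one] at hinv
  refine intervalIntegral.integral_mono_on zero_le_one hinv
    (intervalIntegrable_brannanWeight_mul_inv_one_add_mul hα' hr.1.le p) fun t ht ↦ ?_
  gcongr
  · exact mul_nonneg (brannanWeight_nonneg hα' ht) (pow_nonneg ht.1 p)
  · exact add_pos_of_pos_of_nonneg one_pos (mul_nonneg ht.1 hr.1.le)
  · exact mul_le_of_le_one_right ht.1 hr.2.le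

theorem le_re_brannanCoeff_one {α : ℝ} (hα : α ∈ Ioo (0 : ℝ) 1) {p : ℕ} (hp : Even p) :
    2 ^ α + ∫ t in (0 : ℝ)..1, brannanWeight α t * t ^ p * (1 + t)⁻¹ ≤
      (brannanCoeff (p + 1) α 1 1).re := by
  have hrpow : Continuous fun r : ℝ ↦ (1 + r) ^ α :=
    (continuous_const.add continuous_id).rpow_const fun _ ↦ Or.inr hα.1.le
  have hcoeff : Continuous fun r : ℝ ↦ (brannanCoeff (p + 1) α 1 r).re :=
    Complex.continuous_re.comp
      ((continuous_brannanCoeff_one_right (p + 1) α).comp Complex.continuous_ofReal)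
  have h := le_on_closure (fun r hr ↦ le_re_brannanCoeff_ofReal hα hp hr)
    (hrpow.add (by fun_prop)).continuousOn hcoeff.continuousOn
    (x := 1) (by rw [closure_Ioo zero_ne_one]; exact right_mem_Icc.2 zero_le_one)
  rwa [one_pow, one_mul, one_add_one_eq_two, Complex.ofReal_one] at h

theorem corollary2_general {x : ℂ} (hx : ‖x‖ ≤ 1) {α : ℝ} (hα : α ∈ Ioo (0 : ℝ) 1) {m : ℕ}
    (hm : Odd m) :
    (brannanCoeff m α 1 1).im = 0 ∧ ‖brannanCoeff m α 1 x‖ ≤ (brannanCoeff m α 1 1).re := by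
  constructor
  · rw [← Complex.ofReal_one, brannanCoeff_one_right_ofReal, Complex.ofReal_im]
  · obtain ⟨k, rfl⟩ := hm
    exact (norm_brannanCoeff_le hα (2 * k) hx).trans (le_re_brannanCoeff_one hα (even_two_mul k))

theorem corollary2 (x : ℂ) (hx : ‖x‖ = 1) (α : ℝ) (hα : α ∈ Set.Ioo (0 : ℝ) 1)
    (n : ℕ) (hn : 1 ≤ n) :
    (brannanCoeff (2 * n - 1) α 1 1).im = 0 ∧
      ‖brannanCoeff (2 * n - 1) α 1 x‖ ≤ (brannanCoeff (2 * n - 1) α 1 1).re :=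
  corollary2_general hx.le hα ⟨n - 1, by omega⟩
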